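/- Let $m\ge 1$, let $\mathcal D_m=\langle s,r\mid s^2=r^m=srsr=e\rangle$ be the dihedral group of order $2m$, and let all modules be finite-dimensional over $\mathbb K=\mathbb R$ or $\mathbb C$. Let $\mathrm{id}$ be the trivial character, $\varepsilon$ the linear character with $\varepsilon(r)=1$, $\varepsilon(s)=-1$, and, when $m$ is even, $\gamma$ one of the two linear characters with $\gamma(r)=-1$, $\gamma(s)=\pm1$ (either choice is allowed). For $1\le i<m/2$ let $\chi_i$ be the character with $\chi_i(r^a)=2\cos(2\pi ia/m)$ and $\chi_i(r^as)=0$. Put $y_i=r^{1-i}s+r^i\in\mathbb R\mathcal D_m$. If $m=2k$ is even, let $\mathcal Q=\mathcal L\{e,\,r^k,\,rs,\,r^{k+1}s,\,y_i,\,y_irs\}_{1\le i\le k-1}\subseteq\mathbb R\mathcal D_m$, and if $m=2k+1$ is odd, let $\mathcal Q=\mathcal L\{e,\,rs,\,y_i,\,y_irs\}_{1\le i\le k}$. The listed elements form a basis $\{b_i\}_{i\in I}$ of $\mathcal Q$, the space $\mathcal Q$ is a subalgebra of $\mathbb R\mathcal D_m$, and there is an algebra morphism $\theta:\mathcal Q\to\mathbb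 R\,\mathrm{Irr}(\mathcal D_m)$ given by $\theta(e)=\mathrm{id}$, $\theta(rs)=\varepsilon$, $\theta(y_i)=\theta(y_irs)=\chi_i$ and, for $m$ even, $\theta(r^k)=\gamma$, $\theta(r^{k+1}s)=\gamma\varepsilon$. For $g\in\mathcal D_m$ and $f\in\mathbb R\mathcal D_m$ let $[g]f$ be the coefficient of $g$ in $f$, and let $\mathrm{supp}(f)=\{g\in\mathcal D_m : [g]f\ne0\}$. Let $\Gamma=\Gamma(\mathcal D_m,\mathrm{supp}(f))$ be the oriented Cayley graph with vertex set $\mathcal D_m$ and an edge from $g$ to $ga$ for every $g\in\mathcal D_m$ and $a\in\mathrm{supp}(f)$, where $a$ has weight $\omega(a)=[a]f$. Let $w(\sigma,d;\Gamma)$ be the set of words $w=a_1\cdots a_d$ of length $d$ in the letters $\mathrm{supp}(f)$ that reduce to $\sigma$, i.e. that label a path in $\Gamma$ from $e$ to $\sigma$, and let $\omega(w)=\omega(a_1)\cdots\omega(a_d)$. **Theorem.** Let $V$ be a $\mathcal D_m$-module with character $\chi^V$ and let $f\in\mathcal Q$ satisfy $\theta(f)=\chi^V$. For every $i\in I$ let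 $\sigma_i$ be any element of $\mathrm{supp}(b_i)$. Then for every simple $\mathcal D_m$-module $V^{(k)}$, with character $\chi^{(k)}$, and every $d\ge0$, the multiplicity of $V^{(k)}$ in $V^{\otimes d}$ is equal to $$\sum_{\substack{i\in I\\ \theta(b_i)=\chi^{(k)}}}\ \sum_{w\in w(\sigma_i,d;\Gamma)}\omega(w).$$ -/

import Mathlib

open scoped MonoidAlgebra

noncomputable section

namespace DihedralWords

open DihedralGroup

/-! ### Characters, tensor powers and multiplicities -/

/-- The characters of the irreducible representations of `G` over `𝕜`
(a finite-dimensional representation may be realised on some `𝕜ⁿ`). -/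
def irrCharacters (𝕜 : Type*) [RCLike 𝕜] (G : Type*) [Group G] : Set (G → 𝕜) :=
  {χ | ∃ (n : ℕ) (ρ : Representation 𝕜 G (Fin n → 𝕜)), ρ.IsIrreducible ∧ ρ.character = χ}

/-- The character algebra `ℝ Irr(G)`, with the pointwise operations. -/
def characterAlgebra (𝕜 : Type*) [RCLike 𝕜] (G : Type*) [Group G] : Subalgebra ℝ (G → 𝕜) :=
  Algebra.adjoin ℝ (irrCharacters 𝕜 G)

/-- The diagonal action of `G` on `V^{⊗d}`. -/
def tensorPower {𝕜 : Type*} [RCLike 𝕜] {G : Type*} [Group G] {V : Type*} [AddCommGroup V]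
    [Module 𝕜 V] (ρ : Representation 𝕜 G V) (d : ℕ) :
    Representation 𝕜 G (PiTensorProduct 𝕜 fun _ : Fin d => V) :=
  PiTensorProduct.mapMonoidHom.comp (MonoidHom.pi fun _ : Fin d => ρ)

/-- The multiplicity of the simple module `S` in the (finite-dimensional, semisimple) module `W`:
the number of simple summands isomorphic to `S` in a decomposition of `W`, that is, the length of
the `S`-isotypic component of `W`. -/
def simpleMultiplicity {𝕜 : Type*} [RCLike 𝕜] {G : Type*} [Group G] {S W : Type*} [AddCommGroup S]
    [Module 𝕜 S] [AddCommGroup W] [Module 𝕜 W]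
    (σ : Representation 𝕜 G S) (ρ : Representation 𝕜 G W) : ℕ :=
  (Module.length 𝕜[G] (isotypicComponent 𝕜[G] ρ.asModule σ.asModule)).toNat

/-! ### Words in a weighted Cayley graph -/

/-- In the Cayley graph `Γ(G, A)` there is an edge from `g` to `h` associated to `a`
when `a ∈ A` and `h = g a`. -/
def CayleyEdge {G : Type*} [Group G] (A : Set G) (a g h : G) : Prop :=
  a ∈ A ∧ h = g * a

/-- `CayleyPath A g w h`: the word `w` labels a path from `g` to `h` in `Γ(G, A)`. -/
inductive CayleyPath {G : Type*} [Group G] (A : Set G) : G → List G → G → Prop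
  | nil (g : G) : CayleyPath A g [] g
  | cons {a g h l : G} {w : List G} :
      CayleyEdge A a g h → CayleyPath A h w l → CayleyPath A g (a :: w) l

open scoped Classical in
/-- `w(σ, d; Γ(G, A))`: the words of length `d` which reduce to `σ` in `Γ(G, A)`. -/
def words {G : Type*} [Group G] [Fintype G] (A : Set G) (d : ℕ) (σ : G) :
    Finset (Fin d → G) :=
  Finset.univ.filter fun w => CayleyPath A 1 (List.ofFn w) σ

/-- The weight of a word is the product of the weights of its letters. -/
def wordWeight {G : Type*} (ω : G → ℝ) {d : ℕ} (w : Fin d → G) : ℝ :=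
  ∏ j, ω (w j)

/-- The support of an element of the group algebra. -/
def supp {G : Type*} (f : ℝ[G]) : Set G := {g | f.coeff g ≠ 0}

/-! ### The basis `{bᵢ}` and the irreducible characters of the dihedral group

In `DihedralGroup m` the rotation `rᵃ` is `r a`, the reflection `s` is `sr 0`, and
`sr a = s rᵃ = r⁻ᵃ s`. -/

/-- The index set `I` of the basis `{bᵢ}`. -/
inductive Index (m : ℕ) : Type
  /-- the element `e` -/
  | e : Index m
  /-- the element `r s` -/
  | rs : Index m
  /-- the element `r^k`, when `m = 2k` -/
  | rk (hm : Even m) : Index m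
  /-- the element `r^(k+1) s`, when `m = 2k` -/
  | rks (hm : Even m) : Index m
  /-- the element `yᵢ`, for `1 ≤ i < m / 2` -/
  | y (i : ℕ) (hi : 1 ≤ i ∧ 2 * i < m) : Index m
  /-- the element `yᵢ r s`, for `1 ≤ i < m / 2` -/
  | yrs (i : ℕ) (hi : 1 ≤ i ∧ 2 * i < m) : Index m

/-- `yᵢ = r^(1-i) s + rⁱ`. -/
def yElt (m i : ℕ) : ℝ[DihedralGroup m] :=
  .of ℝ _ (r (1 - (i : ZMod m)) * sr 0) + .of ℝ _ (r (i : ZMod m))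

/-- The elements `bᵢ` of the group algebra. -/
def bElt (m : ℕ) : Index m → ℝ[DihedralGroup m]
  | .e => .of ℝ _ 1
  | .rs => .of ℝ _ (r 1 * sr 0)
  | .rk _ => .of ℝ _ (r ((m / 2 : ℕ) : ZMod m))
  | .rks _ => .of ℝ _ (r ((m / 2 + 1 : ℕ) : ZMod m) * sr 0)
  | .y i _ => yElt m i
  | .yrs i _ => yElt m i * .of ℝ _ (r 1 * sr 0)

/-- The character `ε`: `ε(rᵃ) = 1` and `ε(rᵃ s) = -1`. -/
def epsChar (𝕜 : Type*) [RCLike 𝕜] (m : ℕ) : DihedralGroup m → 𝕜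
  | r _ => 1
  | sr _ => -1

/-- The character `γ` for `m` even: `γ(rᵃ) = (-1)ᵃ` and `γ(rᵃ s) = (-1)ᵃ δ`, where `δ = γ(s)` is
`1` or `-1`. -/
def gammaChar (𝕜 : Type*) [RCLike 𝕜] (m : ℕ) (δ : ℤˣ) : DihedralGroup m → 𝕜
  | r a => (-1) ^ a.val
  | sr a => (-1) ^ a.val * ((δ : ℤ) : 𝕜)

/-- The character `χᵢ`: `χᵢ(rᵃ) = 2 cos (2πia/m)` and `χᵢ(rᵃ s) = 0`. -/
def chiChar (𝕜 : Type*) [RCLike 𝕜] (m i : ℕ) : DihedralGroup m → 𝕜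
  | r a => ((2 * Real.cos (2 * Real.pi * i * a.val / m) : ℝ) : 𝕜)
  | sr _ => 0

/-- The irreducible character `χ⁽ⁱ⁾` attached to the basis element `bᵢ`. -/
def indexChar (𝕜 : Type*) [RCLike 𝕜] (m : ℕ) (δ : ℤˣ) : Index m → DihedralGroup m → 𝕜
  | .e => 1
  | .rs => epsChar 𝕜 m
  | .rk _ => gammaChar 𝕜 m δ
  | .rks _ => gammaChar 𝕜 m δ * epsChar 𝕜 m
  | .y i _ => chiChar 𝕜 m i
  | .yrs i _ => chiChar 𝕜 m i

instance (m : ℕ) : Finite (Index m) := by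
  let F : Index m → Fin 6 × Fin (m + 1) := fun x => match x with
    | .e => (0, 0)
    | .rs => (1, 0)
    | .rk _ => (2, 0)
    | .rks _ => (3, 0)
    | .y i hi => (4, ⟨i, by omega⟩)
    | .yrs i hi => (5, ⟨i, by omega⟩)
  refine Finite.of_injective F ?_
  rintro (_ | _ | _ | _ | _ | _) (_ | _ | _ | _ | _ | _) h <;> simp_all [F]

instance (m : ℕ) : Fintype (Index m) := Fintype.ofFinite _

/-! ### Auxiliary facts: linear independence of the `bᵢ` -/

section Aux

variable {m : ℕ}

/-- `r^c` -/
def auxE (c : ZMod m) : ℝ[DihedralGroup m] := .single (r c) 1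

/-- `r^c (rs)` -/
def auxT (c : ZMod m) : ℝ[DihedralGroup m] := .single (sr (-1 - c)) 1

/-- `r^c + r^(-c) (rs)` -/
def auxY (c : ZMod m) : ℝ[DihedralGroup m] := .single (r c) 1 + .single (sr (c - 1)) 1

lemma bElt_e : bElt m .e = auxE 0 := rfl

lemma bElt_rs : bElt m .rs = auxT 0 := by simp [bElt, auxT]

lemma bElt_rk (h : Even m) : bElt m (.rk h) = auxE ((m / 2 : ℕ) : ZMod m) := rfl

lemma bElt_rks (h : Even m) : bElt m (.rks h) = auxT ((m / 2 : ℕ) : ZMod m) := by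
  simp only [bElt, auxT, MonoidAlgebra.of_apply, r_mul_sr]
  congr 2; push_cast; ring

lemma bElt_y (i : ℕ) (h) : bElt m (.y i h) = auxY (i : ZMod m) := by
  simp only [bElt, yElt, auxY, MonoidAlgebra.of_apply, r_mul_sr]
  rw [add_comm]; congr 3; ring

lemma bElt_yrs (i : ℕ) (h) : bElt m (.yrs i h) = auxY (-(i : ZMod m)) := by
  simp only [bElt, yElt, auxY, MonoidAlgebra.of_apply, r_mul_sr, add_mul,
    MonoidAlgebra.single_mul_single, sr_mul_sr, mul_one]
  congr 3 <;> ring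

/-- the exponent `c` for which `bᵢ` is one of `auxE c`, `auxT c`, `auxY c` -/
def auxLbl : Index m → ℕ
  | .e => 0
  | .rs => 0
  | .rk _ => m / 2
  | .rks _ => m / 2
  | .y i _ => i
  | .yrs i _ => m - i

/-- a representative of the support of `bᵢ` -/
def auxRep : Index m → DihedralGroup m
  | .rs => sr (-1 - ((0 : ℕ) : ZMod m))
  | .rks _ => sr (-1 - ((m / 2 : ℕ) : ZMod m))
  | i => r ((auxLbl i : ℕ) : ZMod m)

lemma auxCast {a b : ℕ} (ha : a < m) (hb : b < m) (h : (a : ZMod m) = b) : a = b := by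
  rw [ZMod.natCast_eq_natCast_iff'] at h
  rwa [Nat.mod_eq_of_lt ha, Nat.mod_eq_of_lt hb] at h

lemma auxAdd {a b : ℕ} (h0 : 0 < a + b) (hm : a + b < m)
    (h : (a : ZMod m) + (b : ZMod m) = 0) : False := by
  have h' : ((a + b : ℕ) : ZMod m) = 0 := by push_cast; exact h
  rw [ZMod.natCast_eq_zero_iff] at h'
  exact absurd (Nat.le_of_dvd h0 h') (by omega)

lemma auxPos {a : ℕ} (h0 : 0 < a) (hm : a < m) (h : (a : ZMod m) = 0) : False :=
  auxAdd (a := a) (b := 0) h0 hm (by simpa using h)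

lemma auxCast_sub {i : ℕ} (h : i ≤ m) : ((m - i : ℕ) : ZMod m) = -(i : ZMod m) := by
  rw [Nat.cast_sub h]; simp

lemma bElt_indep (hm : 0 < m) : LinearIndependent ℝ (bElt m) := by
  let φ : Index m → Module.Dual ℝ ℝ[DihedralGroup m] := fun i =>
    (Finsupp.lapply (auxRep i)).comp (MonoidAlgebra.coeffLinearEquiv ℝ).toLinearMap
  have hφ : ∀ i x, φ i x = x.coeff (auxRep i) := fun i x => rfl
  refine LinearIndependent.of_pairwise_dual_eq_zero_one _ φ ?_ ?_
  · intro i j hij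
    rw [hφ]
    rcases i with _ | _ | hi | hi | ⟨i, hi⟩ | ⟨i, hi⟩ <;>
    rcases j with _ | _ | hj | hj | ⟨j, hj⟩ | ⟨j, hj⟩ <;>
    first
    | exact absurd rfl hij
    | (simp only [bElt_e, bElt_rs, bElt_rk, bElt_rks, bElt_y, bElt_yrs, auxE, auxT, auxY, auxRep,
        auxLbl, MonoidAlgebra.coeff_add, MonoidAlgebra.coeff_single, Finsupp.add_apply,
        Finsupp.single_apply, reduceCtorEq, if_false, r.injEq, sr.injEq, add_zero, zero_add]
       all_goals
        refine if_neg fun h => ?_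
        try simp only [Nat.cast_zero] at h
        try rw [auxCast_sub (by omega)] at h
        try have hi2 := even_iff_two_dvd.mp hi
        try have hj2 := even_iff_two_dvd.mp hj
        first
        | exact auxPos (m := m) (a := j) (by omega) (by omega) (by linear_combination h)
        | exact auxPos (m := m) (a := j) (by omega) (by omega) (by linear_combination -h)
        | exact auxPos (m := m) (a := i) (by omega) (by omega) (by linear_combination -h)
        | exact auxPos (m := m) (a := i) (by omega) (by omega) (by linear_combination h)
        | exact auxAdd (m := m) (a := i) (b := j) (by omega) (by omega) (by linear_combination -h)
        | exact auxAdd (m := m) (a := i) (b := j) (by omega) (by omega) (by linear_combination h)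
        | exact auxAdd (m := m) (a := j) (b := m / 2) (by omega) (by omega) (by linear_combination h)
        | exact auxAdd (m := m) (a := j) (b := m / 2) (by omega) (by omega) (by linear_combination -h)
        | exact auxAdd (m := m) (a := i) (b := m / 2) (by omega) (by omega) (by linear_combination h)
        | exact auxAdd (m := m) (a := i) (b := m / 2) (by omega) (by omega) (by linear_combination -h)
        | exact auxPos (m := m) (a := m / 2) (by omega) (by omega) (by linear_combination h)
        | exact auxPos (m := m) (a := m / 2) (by omega) (by omega) (by linear_combination -h)
        | (have hh := auxCast (m := m) (a := j) (b := m / 2) (by omega) (by omega)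
            (by linear_combination h)
           omega)
        | (have hh := auxCast (m := m) (a := j) (b := m / 2) (by omega) (by omega)
            (by linear_combination -h)
           omega)
        | (have hh := auxCast (m := m) (a := i) (b := m / 2) (by omega) (by omega)
            (by linear_combination -h)
           omega)
        | (have hh := auxCast (m := m) (a := i) (b := j) (by omega) (by omega)
            (by linear_combination -h)
           subst hh
           exact hij rfl)
        | (have hh := auxCast (m := m) (a := i) (b := j) (by omega) (by omega)
            (by linear_combination h)
           subst hh
           exact hij rfl))
  · intro i
    rw [hφ]
    rcases i with _ | _ | hi | hi | ⟨i, hi⟩ | ⟨i, hi⟩ <;>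
    simp [bElt_e, bElt_rs, bElt_rk, bElt_rks, bElt_y, bElt_yrs, auxE, auxT, auxY, auxRep, auxLbl]
    rw [auxCast_sub (by omega)]; simp

/-! ### Auxiliary facts: the `χ⁽ⁱ⁾` are irreducible characters -/

variable {𝕜 : Type*} [RCLike 𝕜]

lemma auxIrr {G V : Type*} [Group G] [AddCommGroup V] [Module 𝕜 V] [Nontrivial V]
    (ρ : Representation 𝕜 G V)
    (h : ∀ p : Submodule 𝕜 V, (∀ g, ∀ v ∈ p, ρ g v ∈ p) → p ≠ ⊥ → p = ⊤) : ρ.IsIrreducible where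
  exists_pair_ne := ⟨⊥, ⊤, fun h => bot_ne_top (α := Submodule 𝕜 V)
    (congrArg Subrepresentation.toSubmodule h)⟩
  eq_bot_or_eq_top p := by
    by_cases hp : p.toSubmodule = ⊥
    · exact Or.inl (Subrepresentation.toSubmodule_injective hp)
    · exact Or.inr (Subrepresentation.toSubmodule_injective
        (h _ (fun g v hv => p.apply_mem_toSubmodule g hv) hp))

lemma auxLin {G : Type*} [Group G] (χ : G →* 𝕜) : ⇑χ ∈ irrCharacters 𝕜 G := by
  refine ⟨1, (algebraMap 𝕜 (Module.End 𝕜 (Fin 1 → 𝕜)) : 𝕜 →* _).comp χ, auxIrr _ ?_, ?_⟩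
  · intro p _ hp
    have : IsSimpleModule 𝕜 (Fin 1 → 𝕜) := isSimpleModule_iff_finrank_eq_one.mpr (by simp)
    exact (eq_bot_or_eq_top p).resolve_left hp
  · ext g
    have : (algebraMap 𝕜 (Module.End 𝕜 (Fin 1 → 𝕜))) (χ g) = χ g • LinearMap.id := rfl
    simp [Representation.character, this]

lemma auxPar (hm : Even m) [NeZero m] (a b : ZMod m) :
    (-1 : 𝕜) ^ (a + b).val = (-1) ^ a.val * (-1) ^ b.val := by
  have h2 : Even (m * ((a.val + b.val) / m)) := hm.mul_right _
  rw [← pow_add, ZMod.val_add]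
  conv_rhs => rw [← Nat.mod_add_div (a.val + b.val) m, pow_add, h2.neg_one_pow, mul_one]

lemma auxPar_neg (hm : Even m) [NeZero m] (a : ZMod m) :
    (-1 : 𝕜) ^ (-a).val = (-1) ^ a.val := by
  have h := auxPar (𝕜 := 𝕜) hm a (-a)
  rw [add_neg_cancel, ZMod.val_zero, pow_zero] at h
  rcases neg_one_pow_eq_or 𝕜 a.val with h1 | h1 <;> rw [h1] at h ⊢ <;>
    first | linear_combination -h | linear_combination h

lemma auxPar_sub (hm : Even m) [NeZero m] (a b : ZMod m) :
    (-1 : 𝕜) ^ (a - b).val = (-1) ^ a.val * (-1) ^ b.val := by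
  rw [sub_eq_add_neg, auxPar hm, auxPar_neg hm]

lemma auxDelta (δ : ℤˣ) : ((δ : ℤ) : 𝕜) * ((δ : ℤ) : 𝕜) = 1 := by
  rcases Int.units_eq_one_or δ with rfl | rfl <;> simp

lemma epsChar_mem : epsChar 𝕜 m ∈ irrCharacters 𝕜 (DihedralGroup m) := by
  let χ : DihedralGroup m →* 𝕜 :=
    { toFun := epsChar 𝕜 m
      map_one' := rfl
      map_mul' := by rintro (a | a) (b | b) <;> simp [epsChar] }
  exact auxLin χ

lemma gammaChar_mem [NeZero m] (hm : Even m) (δ : ℤˣ) :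
    gammaChar 𝕜 m δ ∈ irrCharacters 𝕜 (DihedralGroup m) := by
  let χ : DihedralGroup m →* 𝕜 :=
    { toFun := gammaChar 𝕜 m δ
      map_one' := by rw [one_def]; simp [gammaChar]
      map_mul' := by
        have hd := auxDelta (𝕜 := 𝕜) δ
        rintro (a | a) (b | b) <;> simp [gammaChar, auxPar hm, auxPar_sub hm] <;>
          first
          | ring1
          | linear_combination ((-1 : 𝕜) ^ a.val * (-1) ^ b.val) * hd
          | linear_combination (-((-1 : 𝕜) ^ a.val * (-1) ^ b.val)) * hd }
  exact auxLin χ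

lemma gammaEpsChar_mem [NeZero m] (hm : Even m) (δ : ℤˣ) :
    gammaChar 𝕜 m δ * epsChar 𝕜 m ∈ irrCharacters 𝕜 (DihedralGroup m) := by
  convert gammaChar_mem (𝕜 := 𝕜) hm (-δ) using 1
  ext (a | a) <;> simp [gammaChar, epsChar]

/-- the angle `2πca/m` -/
def auxAng (c a : ZMod m) : ℝ := 2 * Real.pi * c.val * a.val / m

lemma auxAng_comm (c a : ZMod m) : auxAng c a = auxAng a c := by
  simp only [auxAng]; ring

lemma auxAng_add [NeZero m] (c a b : ZMod m) :
    ∃ q : ℕ, auxAng c a + auxAng c b = auxAng c (a + b) + q * (2 * Real.pi) := by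
  have h : (m : ℝ) ≠ 0 := Nat.cast_ne_zero.mpr (NeZero.ne m)
  refine ⟨c.val * ((a.val + b.val) / m), ?_⟩
  have e : ((a.val : ℝ) + b.val) = (a + b).val + m * ((a.val + b.val) / m : ℕ) := by
    rw [ZMod.val_add]; exact_mod_cast (Nat.mod_add_div (a.val + b.val) m).symm
  simp only [auxAng]
  push_cast at e ⊢
  field_simp
  linear_combination (c.val : ℝ) * e

lemma auxCos_add [NeZero m] (c a b : ZMod m) : Real.cos (auxAng c (a + b)) =
    Real.cos (auxAng c a) * Real.cos (auxAng c b) -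
      Real.sin (auxAng c a) * Real.sin (auxAng c b) := by
  obtain ⟨q, hq⟩ := auxAng_add c a b
  rw [← Real.cos_add, hq, Real.cos_add_nat_mul_two_pi]

lemma auxSin_add [NeZero m] (c a b : ZMod m) : Real.sin (auxAng c (a + b)) =
    Real.sin (auxAng c a) * Real.cos (auxAng c b) +
      Real.cos (auxAng c a) * Real.sin (auxAng c b) := by
  obtain ⟨q, hq⟩ := auxAng_add c a b
  rw [← Real.sin_add, hq, Real.sin_add_nat_mul_two_pi]

lemma auxAng_zero (c : ZMod m) : auxAng c 0 = 0 := by simp [auxAng]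

lemma auxCosSin_neg [NeZero m] (c a : ZMod m) :
    Real.cos (auxAng c (-a)) = Real.cos (auxAng c a) ∧
      Real.sin (auxAng c (-a)) = -Real.sin (auxAng c a) := by
  have h1 := auxCos_add c a (-a)
  have h2 := auxSin_add c a (-a)
  have h3 := Real.sin_sq_add_cos_sq (auxAng c a)
  rw [add_neg_cancel, auxAng_zero] at h1 h2
  simp only [Real.cos_zero, Real.sin_zero] at h1 h2
  constructor
  · linear_combination -Real.cos (auxAng c a) * h1 - Real.sin (auxAng c a) * h2 -
      Real.cos (auxAng c (-a)) * h3
  · linear_combination Real.sin (auxAng c a) * h1 - Real.cos (auxAng c a) * h2 -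
      Real.sin (auxAng c (-a)) * h3

/-- the matrices of the two-dimensional representation with character `χᵢ` -/
def auxMat (𝕜 : Type*) [RCLike 𝕜] (c : ZMod m) : DihedralGroup m → Matrix (Fin 2) (Fin 2) 𝕜
  | r a => !![(Real.cos (auxAng c a) : 𝕜), -(Real.sin (auxAng c a) : 𝕜);
      (Real.sin (auxAng c a) : 𝕜), (Real.cos (auxAng c a) : 𝕜)]
  | sr a => !![(Real.cos (auxAng c a) : 𝕜), -(Real.sin (auxAng c a) : 𝕜);
      -(Real.sin (auxAng c a) : 𝕜), -(Real.cos (auxAng c a) : 𝕜)]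

lemma auxMat_mul [NeZero m] (c : ZMod m) (g h : DihedralGroup m) :
    auxMat 𝕜 c (g * h) = auxMat 𝕜 c g * auxMat 𝕜 c h := by
  rcases g with a | a <;> rcases h with b | b <;>
    simp only [r_mul_r, r_mul_sr, sr_mul_r, sr_mul_sr, auxMat, sub_eq_add_neg, auxCos_add,
      auxSin_add, (auxCosSin_neg c _).1, (auxCosSin_neg c _).2] <;>
    ext i j <;> fin_cases i <;> fin_cases j <;>
    simp [Matrix.mul_apply, Fin.sum_univ_two] <;> ring

lemma chiChar_mem [NeZero m] (i : ℕ) (hi : 1 ≤ i ∧ 2 * i < m) :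
    chiChar 𝕜 m i ∈ irrCharacters 𝕜 (DihedralGroup m) := by
  have hm0 : (0 : ℝ) < m := by exact_mod_cast (show 0 < m by omega)
  have hival : (i : ZMod m).val = i := ZMod.val_natCast_of_lt (by omega)
  let M : DihedralGroup m →* Matrix (Fin 2) (Fin 2) 𝕜 :=
    { toFun := auxMat 𝕜 (i : ZMod m)
      map_one' := by
        rw [one_def]
        ext i j
        fin_cases i <;> fin_cases j <;> simp [auxMat, auxAng_zero]
      map_mul' := auxMat_mul _ }
  refine ⟨2, (Matrix.toLinAlgEquiv' : Matrix (Fin 2) (Fin 2) 𝕜 ≃ₐ[𝕜] _).toAlgHom.toMonoidHom.comp M,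
    auxIrr _ ?_, ?_⟩
  · intro p hp hne
    have hp' : ∀ g, ∀ v ∈ p, (auxMat 𝕜 (i : ZMod m) g).mulVec v ∈ p := fun g v hv => hp g v hv
    obtain ⟨v, hv, hv0⟩ := (Submodule.ne_bot_iff p).mp hne
    set S := Real.sin (auxAng (i : ZMod m) 1) with hS
    set C := Real.cos (auxAng (i : ZMod m) 1) with hC
    have hS0 : (S : 𝕜) ≠ 0 := by
      have h1 : (1 : ZMod m).val = 1 := by
        have := ZMod.val_natCast_of_lt (n := m) (a := 1) (by omega)
        simpa using this
      have : 0 < S := by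
        apply Real.sin_pos_of_pos_of_lt_pi
        · simp only [auxAng, hival, h1]
          have := Real.pi_pos
          have : (0 : ℝ) < i := by exact_mod_cast hi.1
          positivity
        · simp only [auxAng, hival, h1]
          rw [div_lt_iff₀ hm0]
          have h2 : (2 * i : ℝ) < m := by exact_mod_cast hi.2
          have := Real.pi_pos
          push_cast
          nlinarith
      exact_mod_cast this.ne'
    have hs : (![v 0, -v 1] : Fin 2 → 𝕜) ∈ p := by
      convert hp' (sr 0) v hv using 1
      ext j; fin_cases j <;> simp [auxMat, auxAng_zero, Matrix.mulVec, dotProduct]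
    have hrot : ∀ w ∈ p, (![C * w 0 - S * w 1, S * w 0 + C * w 1] : Fin 2 → 𝕜) ∈ p := by
      intro w hw
      convert hp' (r 1) w hw using 1
      ext j; fin_cases j <;> simp [auxMat, Matrix.mulVec, dotProduct, hS, hC]; ring
    have key : (![1, 0] : Fin 2 → 𝕜) ∈ p ∧ (![0, 1] : Fin 2 → 𝕜) ∈ p := by
      by_cases h0 : v 0 = 0
      · have h1 : v 1 ≠ 0 := fun h1 => hv0 (by ext j; fin_cases j <;> simp [h0, h1])
        have e2 : (![0, 1] : Fin 2 → 𝕜) ∈ p := by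
          convert p.smul_mem (v 1)⁻¹ hv using 1
          ext j; fin_cases j <;> simp [h0, h1]
        refine ⟨?_, e2⟩
        convert p.smul_mem (S : 𝕜)⁻¹ (p.sub_mem (p.smul_mem (C : 𝕜) e2) (hrot _ e2)) using 1
        ext j; fin_cases j <;> simp [hS0, RCLike.real_smul_eq_coe_mul]
      · have e1 : (![1, 0] : Fin 2 → 𝕜) ∈ p := by
          convert p.smul_mem (2 * v 0)⁻¹ (p.add_mem hv hs) using 1
          ext j
          fin_cases j
          · simp [Matrix.vecHead]
            field_simp
            ring
          · simp [Matrix.vecHead, Matrix.vecTail]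
        refine ⟨e1, ?_⟩
        convert p.smul_mem (S : 𝕜)⁻¹ (p.sub_mem (hrot _ e1) (p.smul_mem (C : 𝕜) e1)) using 1
        ext j; fin_cases j <;> simp [hS0, RCLike.real_smul_eq_coe_mul]
    rw [eq_top_iff]
    intro w _
    convert p.add_mem (p.smul_mem (w 0) key.1) (p.smul_mem (w 1) key.2) using 1
    ext j; fin_cases j <;> simp
  · ext g
    have : LinearMap.trace 𝕜 (Fin 2 → 𝕜) (Matrix.toLin' (auxMat 𝕜 (i : ZMod m) g)) =
        chiChar 𝕜 m i g := by
      rw [Matrix.trace_toLin'_eq]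
      rcases g with a | a <;> simp [auxMat, chiChar, Matrix.trace, auxAng, hival]
      rw [map_ofNat]
      ring
    exact this

lemma indexChar_mem [NeZero m] (δ : ℤˣ) (i : Index m) :
    indexChar 𝕜 m δ i ∈ irrCharacters 𝕜 (DihedralGroup m) := by
  rcases i with _ | _ | h | h | ⟨i, h⟩ | ⟨i, h⟩
  · exact auxLin (1 : DihedralGroup m →* 𝕜)
  · exact epsChar_mem
  · exact gammaChar_mem h δ
  · exact gammaEpsChar_mem h δ
  · exact chiChar_mem i h
  · exact chiChar_mem i h

end Aux

/-! ### The subalgebra `Q` and the morphism `θ` -/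

/-- The linear span `L{bᵢ}`. -/
abbrev dihedralSpan (m : ℕ) : Submodule ℝ ℝ[DihedralGroup m] :=
  Submodule.span ℝ (Set.range (bElt m))

/-- The `bᵢ` form a basis of their span. -/
def dihedralBasis (m : ℕ) [NeZero m] : Module.Basis (Index m) ℝ (dihedralSpan m) :=
  Module.Basis.span (bElt_indep (NeZero.pos m))

/-- The linear map `L{bᵢ} → (D_m → 𝕜)` with `bᵢ ↦ χ⁽ⁱ⁾`. -/
def thetaLin (𝕜 : Type*) [RCLike 𝕜] (m : ℕ) [NeZero m] (δ : ℤˣ) :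
    dihedralSpan m →ₗ[ℝ] (DihedralGroup m → 𝕜) :=
  (dihedralBasis m).constr ℝ (indexChar 𝕜 m δ)

section Aux


variable {m : ℕ} [NeZero m] {𝕜 : Type*} [RCLike 𝕜] {δ : ℤˣ}

/-- `x` lies in the span of the `bᵢ` and is mapped to `X`. -/
def auxMaps (δ : ℤˣ) (x : ℝ[DihedralGroup m]) (X : DihedralGroup m → 𝕜) : Prop :=
  ∃ h : x ∈ dihedralSpan m, thetaLin 𝕜 m δ ⟨x, h⟩ = X

lemma auxMaps_b (i : Index m) : auxMaps δ (bElt m i) (indexChar 𝕜 m δ i) := by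
  have h : bElt m i ∈ dihedralSpan m := Submodule.subset_span ⟨i, rfl⟩
  refine ⟨h, ?_⟩
  have e : (⟨bElt m i, h⟩ : dihedralSpan m) = dihedralBasis m i :=
    (Module.Basis.span_apply (bElt_indep (NeZero.pos m)) i).symm
  rw [thetaLin, e, Module.Basis.constr_basis]

lemma auxMaps_add {x y : ℝ[DihedralGroup m]} {X Y : DihedralGroup m → 𝕜}
    (hx : auxMaps δ x X) (hy : auxMaps δ y Y) : auxMaps δ (x + y) (X + Y) := by
  obtain ⟨hx, ex⟩ := hx
  obtain ⟨hy, ey⟩ := hy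
  refine ⟨Submodule.add_mem _ hx hy, ?_⟩
  rw [← ex, ← ey, ← map_add]
  rfl

lemma auxMaps_smul (t : ℝ) {x : ℝ[DihedralGroup m]} {X : DihedralGroup m → 𝕜}
    (hx : auxMaps δ x X) : auxMaps δ (t • x) (t • X) := by
  obtain ⟨hx, ex⟩ := hx
  refine ⟨Submodule.smul_mem _ t hx, ?_⟩
  rw [← ex, ← map_smul]
  rfl

lemma auxMaps_zero : auxMaps δ (0 : ℝ[DihedralGroup m]) (0 : DihedralGroup m → 𝕜) :=
  ⟨Submodule.zero_mem _, map_zero (thetaLin 𝕜 m δ)⟩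

lemma auxMaps_unique {x : ℝ[DihedralGroup m]} {X Y : DihedralGroup m → 𝕜}
    (hx : auxMaps δ x X) (hy : auxMaps δ x Y) : X = Y := by
  obtain ⟨hx, ex⟩ := hx
  obtain ⟨hy, ey⟩ := hy
  rw [← ex, ← ey]

/-- the image of `auxE c`, for `2c = 0` -/
def auxL (𝕜 : Type*) [RCLike 𝕜] (δ : ℤˣ) (c : ZMod m) : DihedralGroup m → 𝕜
  | r a => (Real.cos (auxAng c a) : 𝕜)
  | sr a => if c = 0 then 1 else (Real.cos (auxAng c a) : 𝕜) * ((δ : ℤ) : 𝕜)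

/-- the image of `auxY c` -/
def auxX (𝕜 : Type*) [RCLike 𝕜] (c : ZMod m) : DihedralGroup m → 𝕜
  | r a => 2 * (Real.cos (auxAng c a) : 𝕜)
  | sr _ => 0

lemma auxHalf {c : ZMod m} (h : c + c = 0) (h0 : c ≠ 0) :
    Even m ∧ c = ((m / 2 : ℕ) : ZMod m) ∧ c.val = m / 2 := by
  have h1 : c.val + c.val = m := by
    have h2 : (c.val + c.val) % m = 0 := by rw [← ZMod.val_add, h, ZMod.val_zero]
    have h3 := ZMod.val_lt c
    have h4 : c.val ≠ 0 := fun h => h0 ((ZMod.val_eq_zero c).mp h)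
    obtain ⟨q, hq⟩ := Nat.dvd_of_mod_eq_zero h2
    have : q = 1 := by
      rcases q with _ | _ | q
      · omega
      · rfl
      · nlinarith
    rw [hq, this, mul_one]
  have h5 : c.val = m / 2 := by omega
  exact ⟨⟨c.val, h1.symm⟩, by rw [← h5, ZMod.natCast_zmod_val], h5⟩

lemma auxCos_half {c : ZMod m} (h : c + c = 0) (h0 : c ≠ 0) (a : ZMod m) :
    Real.cos (auxAng c a) = (-1) ^ a.val := by
  obtain ⟨⟨k, hk⟩, -, hv⟩ := auxHalf h h0
  have hm : (m : ℝ) ≠ 0 := Nat.cast_ne_zero.mpr (NeZero.ne m)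
  have : auxAng c a = a.val * Real.pi := by
    rw [auxAng, hv, show m / 2 = k by omega]
    have : (m : ℝ) = k + k := by exact_mod_cast hk
    field_simp
    rw [this]; ring
  rw [this, Real.cos_nat_mul_pi]

lemma auxSin_half {c : ZMod m} (h : c + c = 0) (a : ZMod m) : Real.sin (auxAng c a) = 0 := by
  have h1 := (auxCosSin_neg a c).2
  rw [neg_eq_of_add_eq_zero_left h, auxAng_comm] at h1
  linarith

lemma auxL_zero : auxL 𝕜 δ (0 : ZMod m) = 1 := by
  ext (a | a) <;> simp [auxL, auxAng]

lemma auxL_half {c : ZMod m} (h : c + c = 0) (h0 : c ≠ 0) :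
    auxL 𝕜 δ c = gammaChar 𝕜 m δ := by
  ext (a | a) <;> simp [auxL, h0, auxCos_half h h0, gammaChar]

lemma auxEps_sq : epsChar 𝕜 m * epsChar 𝕜 m = 1 := by
  ext (a | a) <;> simp [epsChar]

lemma auxL_mul {c d : ZMod m} (hc : c + c = 0) (hd : d + d = 0) :
    auxL 𝕜 δ c * auxL 𝕜 δ d = auxL 𝕜 δ (c + d) := by
  by_cases h0 : c = 0
  · subst h0; rw [auxL_zero, one_mul, zero_add]
  by_cases h1 : d = 0
  · subst h1; rw [auxL_zero, mul_one, add_zero]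
  have : c = d := (auxHalf hc h0).2.1.trans (auxHalf hd h1).2.1.symm
  subst this
  rw [hc, auxL_zero, auxL_half hc h0]
  have hδ := auxDelta (𝕜 := 𝕜) δ
  ext (a | a) <;> simp only [gammaChar, Pi.mul_apply, Pi.one_apply] <;>
    rcases neg_one_pow_eq_or 𝕜 a.val with h | h <;> rw [h] <;> first | ring1 | linear_combination hδ

lemma auxX_mul_L {c d : ZMod m} (hd : d + d = 0) :
    auxX 𝕜 c * auxL 𝕜 δ d = auxX 𝕜 (c + d) := by
  ext (a | a)
  · simp only [auxX, auxL, Pi.mul_apply]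
    rw [auxAng_comm (c + d), auxCos_add, auxAng_comm a d, auxSin_half hd, auxAng_comm a c]
    push_cast; ring
  · simp [auxX]

lemma auxX_mul_eps (c : ZMod m) : auxX 𝕜 c * epsChar 𝕜 m = auxX 𝕜 c := by
  ext (a | a) <;> simp [auxX, epsChar]

lemma auxX_neg (c : ZMod m) : auxX 𝕜 (-c) = auxX 𝕜 c := by
  ext (a | a)
  · simp only [auxX]
    rw [auxAng_comm, (auxCosSin_neg a c).1, auxAng_comm]
  · rfl

lemma auxX_mul (c d : ZMod m) : auxX 𝕜 c * auxX 𝕜 d = auxX 𝕜 (c + d) + auxX 𝕜 (d - c) := by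
  ext (a | a)
  · simp only [auxX, Pi.mul_apply, Pi.add_apply]
    rw [auxAng_comm (c + d), auxAng_comm (d - c), sub_eq_add_neg, auxCos_add, auxCos_add,
      (auxCosSin_neg a c).1, (auxCosSin_neg a c).2, auxAng_comm a d, auxAng_comm a c]
    push_cast; ring
  · simp [auxX]

lemma auxX_nat (i : ℕ) (hi : i < m) : auxX 𝕜 (i : ZMod m) = chiChar 𝕜 m i := by
  ext (a | a)
  · simp [auxX, chiChar, auxAng, ZMod.val_natCast_of_lt hi]
    exact Or.inl (map_ofNat (algebraMap ℝ 𝕜) 2).symm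
  · rfl

lemma auxMaps_E {c : ZMod m} (h : c + c = 0) : auxMaps δ (auxE c) (auxL 𝕜 δ c) := by
  by_cases h0 : c = 0
  · subst h0
    rw [auxL_zero]
    exact auxMaps_b .e
  · obtain ⟨hm, hc, -⟩ := auxHalf h h0
    rw [auxL_half h h0, hc]
    exact auxMaps_b (.rk hm)

lemma auxMaps_T {c : ZMod m} (h : c + c = 0) :
    auxMaps δ (auxT c) (auxL 𝕜 δ c * epsChar 𝕜 m) := by
  by_cases h0 : c = 0
  · subst h0
    rw [auxL_zero, one_mul, ← bElt_rs]
    exact auxMaps_b .rs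
  · obtain ⟨hm, hc, -⟩ := auxHalf h h0
    rw [auxL_half h h0, hc, ← bElt_rks hm]
    exact auxMaps_b (.rks hm)

lemma auxMaps_Y (c : ZMod m) : auxMaps δ (auxY c) (auxX 𝕜 c) := by
  by_cases h : c + c = 0
  · have e1 : auxY c = auxE c + auxT c := by
      have : c = -c := eq_neg_of_add_eq_zero_left h
      rw [auxY, auxE, auxT]
      congr 3
      linear_combination h
    have e2 : auxX 𝕜 c = auxL 𝕜 δ c + auxL 𝕜 δ c * epsChar 𝕜 m := by
      ext (a | a) <;> simp [auxX, auxL, epsChar]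
      ring
    rw [e1, e2]
    exact auxMaps_add (auxMaps_E h) (auxMaps_T h)
  · have hlt := ZMod.val_lt c
    have h0 : c.val ≠ 0 := fun h0 => h (by rw [(ZMod.val_eq_zero c).mp h0, add_zero])
    have h1 : c.val + c.val ≠ m := fun h1 => h (by
      rw [← ZMod.natCast_zmod_val c, ← Nat.cast_add, h1, ZMod.natCast_self])
    by_cases h2 : 2 * c.val < m
    · have h3 := auxMaps_b (𝕜 := 𝕜) (δ := δ) (.y c.val ⟨by omega, h2⟩)
      rw [bElt_y, ZMod.natCast_zmod_val] at h3
      convert h3 using 1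
      rw [indexChar, ← auxX_nat _ hlt, ZMod.natCast_zmod_val]
    · have h3 := auxMaps_b (𝕜 := 𝕜) (δ := δ) (.yrs (m := m) (m - c.val) ⟨by omega, by omega⟩)
      rw [bElt_yrs, auxCast_sub hlt.le, ZMod.natCast_zmod_val, neg_neg] at h3
      convert h3 using 1
      rw [indexChar, ← auxX_nat (m := m) (m - c.val) (by omega), auxCast_sub hlt.le, ZMod.natCast_zmod_val, auxX_neg]

lemma auxForm (δ : ℤˣ) (i : Index m) :
    (∃ c : ZMod m, c + c = 0 ∧ bElt m i = auxE c ∧ indexChar 𝕜 m δ i = auxL 𝕜 δ c) ∨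
    (∃ c : ZMod m, c + c = 0 ∧ bElt m i = auxT c ∧
      indexChar 𝕜 m δ i = auxL 𝕜 δ c * epsChar 𝕜 m) ∨
    (∃ c : ZMod m, bElt m i = auxY c ∧ indexChar 𝕜 m δ i = auxX 𝕜 c) := by
  have hk : ∀ h : Even m, ((m / 2 : ℕ) : ZMod m) + ((m / 2 : ℕ) : ZMod m) = 0 ∧
      ((m / 2 : ℕ) : ZMod m) ≠ 0 := by
    intro h
    have hm := NeZero.pos m
    have h2 := even_iff_two_dvd.mp h
    constructor
    · rw [← Nat.cast_add, show m / 2 + m / 2 = m by omega, ZMod.natCast_self]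
    · exact fun h => auxPos (by omega) (by omega) h
  rcases i with _ | _ | h | h | ⟨i, h⟩ | ⟨i, h⟩
  · exact Or.inl ⟨0, add_zero _, bElt_e, by rw [auxL_zero]; rfl⟩
  · exact Or.inr (Or.inl ⟨0, add_zero _, bElt_rs, by rw [auxL_zero, one_mul]; rfl⟩)
  · exact Or.inl ⟨_, (hk h).1, bElt_rk h, by rw [auxL_half (hk h).1 (hk h).2]; rfl⟩
  · exact Or.inr (Or.inl ⟨_, (hk h).1, bElt_rks h, by
      rw [auxL_half (hk h).1 (hk h).2]; rfl⟩)
  · exact Or.inr (Or.inr ⟨_, bElt_y i h, by rw [auxX_nat i (by omega)]; rfl⟩)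
  · exact Or.inr (Or.inr ⟨_, bElt_yrs i h, by rw [auxX_neg, auxX_nat i (by omega)]; rfl⟩)

lemma auxMaps_mul (i j : Index m) : auxMaps δ (bElt m i * bElt m j)
    (indexChar 𝕜 m δ i * indexChar 𝕜 m δ j) := by
  have hs : ∀ {c d : ZMod m}, c + c = 0 → d + d = 0 → (c + d) + (c + d) = 0 := by
    intro c d hc hd; linear_combination hc + hd
  rcases auxForm (𝕜 := 𝕜) δ i with ⟨c, hc, e1, f1⟩ | ⟨c, hc, e1, f1⟩ | ⟨c, e1, f1⟩ <;>
  rcases auxForm (𝕜 := 𝕜) δ j with ⟨d, hd, e2, f2⟩ | ⟨d, hd, e2, f2⟩ | ⟨d, e2, f2⟩ <;>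
  rw [e1, e2, f1, f2]
  · convert auxMaps_E (δ := δ) (hs hc hd) using 1
    · simp [auxE]
    · rw [auxL_mul hc hd]
  · convert auxMaps_T (δ := δ) (hs hc hd) using 1
    · simp only [auxE, auxT, MonoidAlgebra.single_mul_single, r_mul_sr, mul_one]
      congr 2; ring
    · rw [← auxL_mul hc hd, mul_assoc]
  · convert auxMaps_Y (δ := δ) (d + c) using 1
    · simp only [auxE, auxY, MonoidAlgebra.single_mul_single, r_mul_sr, r_mul_r, mul_one, mul_add]
      congr 3 <;> first | ring1 | linear_combination -hc
    · rw [mul_comm, auxX_mul_L hc]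
  · convert auxMaps_T (δ := δ) (hs hc hd) using 1
    · simp only [auxE, auxT, MonoidAlgebra.single_mul_single, sr_mul_r, mul_one]
      congr 2; linear_combination hd
    · rw [← auxL_mul hc hd]; ring
  · convert auxMaps_E (δ := δ) (hs hc hd) using 1
    · simp only [auxE, auxT, MonoidAlgebra.single_mul_single, sr_mul_sr, mul_one]
      congr 2; linear_combination -hd
    · rw [← auxL_mul hc hd]
      linear_combination auxL 𝕜 δ c * auxL 𝕜 δ d * auxEps_sq (𝕜 := 𝕜) (m := m)
  · convert auxMaps_Y (δ := δ) (d + c) using 1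
    · simp only [auxT, auxY, MonoidAlgebra.single_mul_single, sr_mul_r, sr_mul_sr, mul_one, mul_add]
      rw [add_comm]
      congr 3 <;> first | ring1 | linear_combination -hc
    · rw [mul_assoc, mul_comm (epsChar 𝕜 m), auxX_mul_eps, mul_comm, auxX_mul_L hc]
  · convert auxMaps_Y (δ := δ) (c + d) using 1
    · simp only [auxE, auxY, MonoidAlgebra.single_mul_single, r_mul_r, sr_mul_r, mul_one, add_mul]
      congr 3; ring
    · rw [auxX_mul_L hd]
  · convert auxMaps_Y (δ := δ) (-(c + d)) using 1
    · simp only [auxT, auxY, MonoidAlgebra.single_mul_single, r_mul_sr, sr_mul_sr, mul_one, add_mul]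
      rw [add_comm]
      congr 3 <;> ring
    · rw [auxX_neg, ← auxX_mul_L hd, ← mul_assoc, auxX_mul_L hd, auxX_mul_eps]
  · convert auxMaps_add (δ := δ) (auxMaps_Y (𝕜 := 𝕜) (c + d)) (auxMaps_Y (d - c)) using 1
    · simp only [auxY, MonoidAlgebra.single_mul_single, r_mul_sr, sr_mul_sr, sr_mul_r, r_mul_r,
        mul_one, add_mul, mul_add]
      rw [show d - 1 - (c - 1) = d - c by ring, show c - 1 + d = c + d - 1 by ring,
        show d - 1 - c = d - c - 1 by ring]
      abel
    · rw [auxX_mul]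

lemma auxMaps_mul' {x y : ℝ[DihedralGroup m]} (hx : x ∈ dihedralSpan m)
    (hy : y ∈ dihedralSpan m) : ∃ X Y : DihedralGroup m → 𝕜,
      auxMaps δ x X ∧ auxMaps δ y Y ∧ auxMaps δ (x * y) (X * Y) := by
  obtain ⟨Y, hY⟩ : ∃ Y : DihedralGroup m → 𝕜, auxMaps δ y Y := ⟨_, hy, rfl⟩
  have step : ∀ i, auxMaps δ (bElt m i * y) (indexChar 𝕜 m δ i * Y) := by
    intro i
    have : ∃ Z, auxMaps δ y Z ∧ auxMaps δ (bElt m i * y) (indexChar 𝕜 m δ i * Z) := by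
      clear hY
      induction hy using Submodule.span_induction with
      | mem z hz =>
        obtain ⟨j, rfl⟩ := hz
        exact ⟨_, auxMaps_b j, auxMaps_mul i j⟩
      | zero => exact ⟨0, auxMaps_zero, by simpa using auxMaps_zero⟩
      | add a b _ _ ha hb =>
        obtain ⟨A, ha, ha'⟩ := ha
        obtain ⟨B, hb, hb'⟩ := hb
        exact ⟨A + B, auxMaps_add ha hb, by simpa only [mul_add] using auxMaps_add ha' hb'⟩
      | smul t a _ ha =>
        obtain ⟨A, ha, ha'⟩ := ha
        exact ⟨t • A, auxMaps_smul t ha, by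
          simpa only [mul_smul_comm] using auxMaps_smul t ha'⟩
    obtain ⟨Z, h1, h2⟩ := this
    rwa [auxMaps_unique hY h1]
  suffices ∃ X, auxMaps δ x X ∧ auxMaps δ (x * y) (X * Y) by
    obtain ⟨X, h1, h2⟩ := this
    exact ⟨X, Y, h1, hY, h2⟩
  induction hx using Submodule.span_induction with
  | mem z hz =>
    obtain ⟨i, rfl⟩ := hz
    exact ⟨_, auxMaps_b i, step i⟩
  | zero => exact ⟨0, auxMaps_zero, by simpa using auxMaps_zero⟩
  | add a b _ _ ha hb =>
    obtain ⟨A, ha, ha'⟩ := ha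
    obtain ⟨B, hb, hb'⟩ := hb
    exact ⟨A + B, auxMaps_add ha hb, by simpa only [add_mul] using auxMaps_add ha' hb'⟩
  | smul t a _ ha =>
    obtain ⟨A, ha, ha'⟩ := ha
    exact ⟨t • A, auxMaps_smul t ha, by
      simpa only [smul_mul_assoc] using auxMaps_smul t ha'⟩

end Aux

lemma bElt_mem_span {m : ℕ} (i : Index m) : bElt m i ∈ dihedralSpan m :=
  Submodule.subset_span ⟨i, rfl⟩

/-- The subalgebra `Q = L{bᵢ}` of the group algebra. -/
def dihedralQ (m : ℕ) [NeZero m] : Subalgebra ℝ ℝ[DihedralGroup m] :=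
  (dihedralSpan m).toSubalgebra (bElt_mem_span .e) fun _ _ hx hy => by
    obtain ⟨X, Y, -, -, h⟩ := auxMaps_mul' (𝕜 := ℝ) (δ := 1) hx hy
    exact h.1

lemma bElt_mem {m : ℕ} [NeZero m] (i : Index m) : bElt m i ∈ dihedralQ m := bElt_mem_span i

lemma thetaLin_b {𝕜 : Type*} [RCLike 𝕜] {m : ℕ} [NeZero m] (δ : ℤˣ) (i : Index m) :
    thetaLin 𝕜 m δ ⟨bElt m i, bElt_mem_span i⟩ = indexChar 𝕜 m δ i :=
  (auxMaps_b i).2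

lemma thetaLin_mem {𝕜 : Type*} [RCLike 𝕜] {m : ℕ} [NeZero m] (δ : ℤˣ) (f : dihedralSpan m) :
    thetaLin 𝕜 m δ f ∈ characterAlgebra 𝕜 (DihedralGroup m) := by
  rw [thetaLin, Module.Basis.constr_apply_fintype]
  exact sum_mem fun i _ => Subalgebra.smul_mem _ (Algebra.subset_adjoin (indexChar_mem δ i)) _

/-- The algebra morphism `θ : Q → ℝ Irr(D_m)` with `θ(bᵢ) = χ⁽ⁱ⁾`. -/
def theta (𝕜 : Type*) [RCLike 𝕜] (m : ℕ) [NeZero m] (δ : ℤˣ) :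
    dihedralQ m →ₐ[ℝ] characterAlgebra 𝕜 (DihedralGroup m) where
  toFun f := ⟨thetaLin 𝕜 m δ ⟨f.1, f.2⟩, thetaLin_mem δ _⟩
  map_one' := Subtype.ext (thetaLin_b δ .e)
  map_mul' f g := Subtype.ext <| by
    obtain ⟨X, Y, ⟨_, h1⟩, ⟨_, h2⟩, ⟨_, h3⟩⟩ := auxMaps_mul' (𝕜 := 𝕜) (δ := δ) f.2 g.2
    change thetaLin 𝕜 m δ ⟨f.1 * g.1, _⟩ =
      thetaLin 𝕜 m δ ⟨f.1, f.2⟩ * thetaLin 𝕜 m δ ⟨g.1, g.2⟩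
    rw [h1, h2, h3]
  map_zero' := Subtype.ext auxMaps_zero.2
  map_add' f g := Subtype.ext (auxMaps_add ⟨f.2, rfl⟩ ⟨g.2, rfl⟩).2
  commutes' t := Subtype.ext <| by
    have h := (auxMaps_smul t (auxMaps_b (𝕜 := 𝕜) (m := m) (δ := δ) .e)).2
    have e : algebraMap ℝ ℝ[DihedralGroup m] t = t • bElt m .e := by
      rw [Algebra.algebraMap_eq_smul_one]; rfl
    change thetaLin 𝕜 m δ ⟨algebraMap ℝ ℝ[DihedralGroup m] t, _⟩ = algebraMap ℝ _ t
    simp only [e]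
    rw [h, Algebra.algebraMap_eq_smul_one]
    rfl

/-- The elements `bᵢ` of `Q`. -/
def b {m : ℕ} [NeZero m] (i : Index m) : dihedralQ m := ⟨bElt m i, bElt_mem i⟩

lemma theta_b {𝕜 : Type*} [RCLike 𝕜] {m : ℕ} [NeZero m] (δ : ℤˣ) (i : Index m) :
    (theta 𝕜 m δ (b i) : DihedralGroup m → 𝕜) = indexChar 𝕜 m δ i :=
  thetaLin_b δ i

end DihedralWords

end

/-!
The coefficient of `σ` in `f ^ d` is the weighted number of words of length `d` that reduce to
`σ`. Each `bᵢ` has coefficient `1` at every point of its support, and distinct `bᵢ` have disjoint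
supports, so the coefficient of `f ^ d ∈ Q` at `σᵢ` is its coordinate along `bᵢ`. As `θ` is
multiplicative, `θ(f ^ d) = (χ^V) ^ d` is the character of `V^{⊗d}`, and these coordinates express
it as a combination of the irreducible characters `θ(bᵢ)`.

The multiplicity of `S` is then read off by pairing with `χ^S`. Over `ℝ` the norm `⟨χ^S, χ^S⟩` is
`dim End(S)` and may exceed `1`, but the same factor occurs in
`⟨χ^W, χ^S⟩ = dim Hom(S, W) = (multiplicity of S in W) * dim End(S)`, and it cancels.
-/

namespace DihedralWords

open DihedralGroup

section IsotypicComponent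

variable {k A S W : Type*} [Field k] [Ring A] [Algebra k A]
  [AddCommGroup S] [Module A S]
  [AddCommGroup W] [Module k W] [Module A W] [IsScalarTower k A W]

lemma bijective_compRight_subtype_isotypicComponent [IsSimpleModule A S] :
    Function.Bijective (LinearMap.compRight k (M := S) (isotypicComponent A W S).subtype) where
  left _ _ h := LinearMap.ext fun x => Subtype.ext (LinearMap.congr_fun h x)
  right φ := by
    have hφ (x : S) : φ x ∈ isotypicComponent A W S :=
      φ.le_comap_isotypicComponent S
        ((le_sSup ⟨Submodule.topEquiv⟩ : ⊤ ≤ isotypicComponent A S S) trivial)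
    exact ⟨φ.codRestrict _ hφ, rfl⟩

variable [Module k S] [IsScalarTower k A S]

lemma finrank_linearMap_of_linearEquiv_pi [Module.Finite k S] {ι : Type*} [Fintype ι]
    (e : W ≃ₗ[A] (ι → S)) :
    Module.finrank k (S →ₗ[A] W) = Fintype.card ι * Module.finrank k (S →ₗ[A] S) := by
  have : Module.Finite k (S →ₗ[A] S) :=
    .of_injective (LinearMap.restrictScalarsₗ k A S S k) (LinearMap.restrictScalars_injective k)
  have hbij : Function.Bijective (LinearMap.compRight k (M := S) e.toLinearMap) :=
    ⟨fun _ _ h => LinearMap.ext fun x => e.injective (LinearMap.congr_fun h x),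
      fun φ => ⟨e.symm.toLinearMap ∘ₗ φ, by ext; simp⟩⟩
  rw [((LinearEquiv.ofBijective _ hbij).trans (LinearEquiv.linearMapPi k).symm).finrank_eq,
    Module.finrank_pi_fintype, Finset.sum_const, Finset.card_univ, smul_eq_mul]

lemma length_isotypicComponent_mul_finrank [IsSimpleModule A S] [Module.Finite k S]
    [Module.Finite k W] :
    (Module.length A (isotypicComponent A W S)).toNat * Module.finrank k (S →ₗ[A] S) =
      Module.finrank k (S →ₗ[A] W) := by
  have : IsNoetherian A W := isNoetherian_of_tower k inferInstance
  obtain ⟨n, ⟨e⟩⟩ := (IsIsotypicOfType.isotypicComponent A W S).linearEquiv_fun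
  have hlength : (Module.length A (isotypicComponent A W S)).toNat = n := by
    simp [e.length_eq, Module.length_pi_of_fintype, Module.length_eq_one]
  calc _ = Fintype.card (Fin n) * Module.finrank k (S →ₗ[A] S) := by
        rw [hlength, Fintype.card_fin]
    _ = Module.finrank k (S →ₗ[A] isotypicComponent A W S) :=
        (finrank_linearMap_of_linearEquiv_pi e).symm
    _ = Module.finrank k (S →ₗ[A] W) :=
        (LinearEquiv.ofBijective _ bijective_compRight_subtype_isotypicComponent).finrank_eq

end IsotypicComponent

section Multiplicity

lemma finrank_intertwiningMap_self_ne_zero {k G V : Type*} [Field k] [Monoid G]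
    [AddCommGroup V] [Module k V] [FiniteDimensional k V]
    (τ : Representation k G V) [τ.IsIrreducible] :
    Module.finrank k (τ.IntertwiningMap τ) ≠ 0 := by
  have : IsSimpleModule k[G] τ.asModule :=
    (Representation.irreducible_iff_isSimpleModule_asModule τ).mp inferInstance
  have : Nontrivial τ.asModule := IsSimpleModule.nontrivial k[G] τ.asModule
  have : Nontrivial (τ.IntertwiningMap τ) :=
    (Representation.IntertwiningMap.equivLinearMapAsModule τ τ).toEquiv.nontrivial
  have : Module.Finite k (τ.IntertwiningMap τ) :=
    .of_injective (Representation.IntertwiningMap.toLinearMapl τ τ)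
      fun _ _ h => Representation.IntertwiningMap.ext h
  exact Module.finrank_pos.ne'

variable {𝕜 : Type*} [RCLike 𝕜] {G : Type*} [Group G]
  {S W : Type*} [AddCommGroup S] [Module 𝕜 S] [FiniteDimensional 𝕜 S]
  [AddCommGroup W] [Module 𝕜 W] [FiniteDimensional 𝕜 W]
  (τ : Representation 𝕜 G S) (ρ : Representation 𝕜 G W)

lemma simpleMultiplicity_mul_finrank [τ.IsIrreducible] :
    simpleMultiplicity τ ρ * Module.finrank 𝕜 (τ.IntertwiningMap τ) =
      Module.finrank 𝕜 (τ.IntertwiningMap ρ) := by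
  have : IsSimpleModule 𝕜[G] τ.asModule :=
    (Representation.irreducible_iff_isSimpleModule_asModule τ).mp inferInstance
  rw [(Representation.IntertwiningMap.equivLinearMapAsModule τ τ).finrank_eq,
    (Representation.IntertwiningMap.equivLinearMapAsModule τ ρ).finrank_eq]
  exact length_isotypicComponent_mul_finrank

lemma card_inv_mul_sum_mul_character_inv [Fintype G] [τ.IsIrreducible] {χ : G → 𝕜}
    (hχ : χ ∈ irrCharacters 𝕜 G) [Decidable (χ = τ.character)] :
    (Nat.card G : 𝕜)⁻¹ * ∑ g, χ g * τ.character g⁻¹ =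
      if χ = τ.character then (Module.finrank 𝕜 (τ.IntertwiningMap τ) : 𝕜) else 0 := by
  let : Invertible (Nat.card G : 𝕜) := invertibleOfNonzero (by simp)
  split_ifs with h
  · rw [h, Representation.card_inv_mul_sum_char_mul_char_eq_finrank]
  · obtain ⟨n, π, hπ, rfl⟩ := hχ
    have : IsEmpty (τ.Equiv π) := ⟨fun e => h (Representation.char_iso e).symm⟩
    rw [Representation.card_inv_mul_sum_char_mul_char_eq_finrank,
      Module.finrank_zero_of_subsingleton, Nat.cast_zero]

lemma simpleMultiplicity_eq_sum [Finite G] [τ.IsIrreducible] {ι : Type*} [Fintype ι] {χ : ι → G → 𝕜}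
    (hχ : ∀ i, χ i ∈ irrCharacters 𝕜 G) {c : ι → ℝ} (h : ρ.character = ∑ i, c i • χ i)
    [DecidablePred fun i => χ i = τ.character] :
    (simpleMultiplicity τ ρ : ℝ) = ∑ i with χ i = τ.character, c i := by
  have := Fintype.ofFinite G
  let : Invertible (Nat.card G : 𝕜) := invertibleOfNonzero (by simp)
  set D : 𝕜 := (Module.finrank 𝕜 (τ.IntertwiningMap τ) : 𝕜)
  have hD : D ≠ 0 := Nat.cast_ne_zero.mpr (finrank_intertwiningMap_self_ne_zero τ)
  have hmul : (simpleMultiplicity τ ρ : 𝕜) * D = (∑ i with χ i = τ.character, (c i : 𝕜)) * D :=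
    calc (simpleMultiplicity τ ρ : 𝕜) * D
        = (Nat.card G : 𝕜)⁻¹ * ∑ g, ρ.character g * τ.character g⁻¹ := by
          rw [Representation.card_inv_mul_sum_char_mul_char_eq_finrank,
            ← simpleMultiplicity_mul_finrank, Nat.cast_mul]
      _ = ∑ i, (c i : 𝕜) * ((Nat.card G : 𝕜)⁻¹ * ∑ g, χ i g * τ.character g⁻¹) := by
          simp only [h, Finset.sum_apply, Pi.smul_apply, RCLike.real_smul_eq_coe_mul,
            Finset.sum_mul, Finset.mul_sum]
          rw [Finset.sum_comm]
          refine Finset.sum_congr rfl fun i _ => Finset.sum_congr rfl fun g _ => by ring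
      _ = ∑ i, (c i : 𝕜) * if χ i = τ.character then D else 0 :=
          Finset.sum_congr rfl fun i _ => by rw [card_inv_mul_sum_mul_character_inv τ (hχ i)]
      _ = (∑ i with χ i = τ.character, (c i : 𝕜)) * D := by
          simp only [mul_ite, mul_zero, Finset.sum_filter, Finset.sum_mul, ite_mul, zero_mul]
  exact_mod_cast mul_right_cancel₀ hD hmul

end Multiplicity

section TensorPower

lemma trace_piTensorProduct_map {R M ι : Type*} [CommRing R] [AddCommGroup M] [Module R M]
    [Module.Free R M] [Module.Finite R M] [Fintype ι] (f : ι → M →ₗ[R] M) :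
    LinearMap.trace R _ (PiTensorProduct.map f) = ∏ i, LinearMap.trace R M (f i) := by
  classical
  let b := Module.Free.chooseBasis R M
  simp_rw [LinearMap.trace_eq_matrix_trace R (Basis.piTensorProduct fun _ : ι => b),
    LinearMap.trace_eq_matrix_trace R b, Matrix.trace, Finset.prod_univ_sum, Fintype.piFinset_univ]
  refine Finset.sum_congr rfl fun p _ => ?_
  simp [LinearMap.toMatrix_apply]

lemma character_tensorPower {𝕜 : Type*} [RCLike 𝕜] {G : Type*} [Group G] {V : Type*}
    [AddCommGroup V] [Module 𝕜 V] [FiniteDimensional 𝕜 V] (ρ : Representation 𝕜 G V) (d : ℕ) :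
    (tensorPower ρ d).character = ρ.character ^ d := by
  ext g
  calc (tensorPower ρ d).character g
      = ∏ _ : Fin d, ρ.character g := trace_piTensorProduct_map fun _ : Fin d => ρ g
    _ = (ρ.character ^ d) g := by simp

end TensorPower

section Words

lemma cayleyPath_iff {G : Type*} [Group G] {A : Set G} {g h : G} {w : List G} :
    CayleyPath A g w h ↔ (∀ a ∈ w, a ∈ A) ∧ g * w.prod = h := by
  constructor
  · intro hpath
    induction hpath with
    | nil g => simp
    | cons hedge _ ih =>
      obtain ⟨ha, rfl⟩ := hedge
      exact ⟨List.forall_mem_cons.mpr ⟨ha, ih.1⟩, by rw [List.prod_cons, ← mul_assoc, ih.2]⟩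
  · rintro ⟨hA, rfl⟩
    induction w generalizing g with
    | nil => simpa using CayleyPath.nil g
    | cons a w ih =>
      obtain ⟨ha, hw⟩ := List.forall_mem_cons.mp hA
      rw [List.prod_cons, ← mul_assoc]
      exact .cons ⟨ha, rfl⟩ (ih hw)

lemma pow_eq_sum_single {R G : Type*} [CommSemiring R] [Monoid G] [Fintype G] (f : R[G]) (d : ℕ) :
    f ^ d = ∑ w : Fin d → G, .single (List.ofFn w).prod (∏ j, f.coeff (w j)) := by
  induction d with
  | zero => simp [MonoidAlgebra.one_def]
  | succ d ih =>
    have hf : f = ∑ a, .single a (f.coeff a) := by ext g; simp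
    rw [pow_succ', ih, ← (Fin.consEquiv fun _ : Fin (d + 1) => G).sum_comp,
      Fintype.sum_prod_type]
    nth_rw 1 [hf]
    simp [Finset.sum_mul_sum, Fin.consEquiv, Fin.prod_univ_succ]

lemma wordWeight_coeff_ne_zero {G : Type*} {f : ℝ[G]} {d : ℕ} {w : Fin d → G} :
    wordWeight f.coeff w ≠ 0 ↔ ∀ j, w j ∈ supp f := by
  simp only [wordWeight, Finset.prod_ne_zero_iff, Finset.mem_univ, true_imp_iff]
  rfl

lemma sum_wordWeight_words {G : Type*} [Group G] [Fintype G] (f : ℝ[G]) (d : ℕ) (σ : G) :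
    ∑ w ∈ words (supp f) d σ, wordWeight f.coeff w = (f ^ d).coeff σ := by
  classical
  have hwords : words (supp f) d σ =
      ({w | (List.ofFn w).prod = σ ∧ wordWeight f.coeff w ≠ 0} : Finset (Fin d → G)) := by
    ext w
    simp only [words, Finset.mem_filter_univ, cayleyPath_iff, one_mul, List.forall_mem_ofFn_iff,
      wordWeight_coeff_ne_zero, and_comm]
  rw [hwords, ← Finset.filter_filter, Finset.sum_filter_ne_zero, Finset.sum_filter,
    pow_eq_sum_single]
  simp only [MonoidAlgebra.coeff_sum, Finsupp.finsetSum_apply, MonoidAlgebra.coeff_single,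
    Finsupp.single_apply, wordWeight]

end Words

lemma eq_sum_coeff_smul {R G ι : Type*} [Semiring R] [Fintype ι] [DecidableEq ι]
    {b : ι → R[G]} {σ : ι → G} (hσ : ∀ i j, (b j).coeff (σ i) = if j = i then 1 else 0)
    {x : R[G]} (hx : x ∈ Submodule.span R (Set.range b)) :
    x = ∑ i, x.coeff (σ i) • b i := by
  obtain ⟨c, rfl⟩ := (Submodule.mem_span_range_iff_exists_fun R).mp hx
  simp [hσ]

section Dihedral

variable {m : ℕ}

/-- The `c ∈ ℤ/m` for which `g` is one of the two elements `rᶜ` and `r⁻ᶜ(rs)` of `D_m`. -/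
def exponent : DihedralGroup m → ZMod m
  | r a => a
  | sr a => a + 1

@[simp]
lemma exponent_r (a : ZMod m) : exponent (r a) = a := rfl

@[simp]
lemma exponent_sr (a : ZMod m) : exponent (sr a) = a + 1 := rfl

/-- The basis element `bᵢ` whose support contains `g`, as a function of `g`: it is `g` itself when
the exponent `c` of `g` satisfies `2c = 0`, and `rᶜ + r⁻ᶜ(rs)` otherwise. -/
noncomputable def block (g : DihedralGroup m) : ℝ[DihedralGroup m] :=
  if exponent g + exponent g = 0 then .single g 1 else auxY (exponent g)

lemma natCast_half_add_self (hm : Even m) :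
    ((m / 2 : ℕ) : ZMod m) + ((m / 2 : ℕ) : ZMod m) = 0 := by
  rw [← Nat.cast_add, ← two_mul, Nat.two_mul_div_two_of_even hm, ZMod.natCast_self]

lemma natCast_add_self_ne_zero {i : ℕ} (hi : 1 ≤ i ∧ 2 * i < m) : (i : ZMod m) + i ≠ 0 :=
  auxAdd (by omega) (by omega)

lemma exists_block_eq_bElt (i : Index m) : ∃ g, block g = bElt m i := by
  rcases i with _ | _ | hm | hm | ⟨i, hi⟩ | ⟨i, hi⟩
  · exact ⟨r 0, by simp [block, exponent, bElt_e, auxE]⟩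
  · exact ⟨sr (-1 - 0), by simp [block, exponent, bElt_rs, auxT]⟩
  · exact ⟨r (m / 2 : ℕ), if_pos (natCast_half_add_self hm)⟩
  · refine ⟨sr (-1 - (m / 2 : ℕ)), (if_pos ?_).trans (bElt_rks hm).symm⟩
    rw [exponent_sr]
    linear_combination -natCast_half_add_self hm
  · exact ⟨r i, (if_neg (natCast_add_self_ne_zero hi)).trans (bElt_y i hi).symm⟩
  · refine ⟨r (-i), (if_neg fun h => natCast_add_self_ne_zero hi ?_).trans (bElt_yrs i hi).symm⟩
    rw [exponent_r] at h
    linear_combination -h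

lemma coeff_block_self (g : DihedralGroup m) : (block g).coeff g = 1 := by
  unfold block
  split_ifs
  · simp
  · cases g <;> simp [auxY, exponent]

lemma exponent_eq_of_mem_supp_auxY {c : ZMod m} {g : DihedralGroup m} (hg : g ∈ supp (auxY c)) :
    exponent g = c := by
  contrapose! hg
  cases g <;> simp_all [supp, auxY, Finsupp.single_apply, eq_sub_iff_add_eq, eq_comm]

lemma block_eq_of_mem_supp {g h : DihedralGroup m} (hg : g ∈ supp (block h)) :
    block g = block h := by
  by_cases hh : exponent h + exponent h = 0
  · have hblock : block h = .single h 1 := if_pos hh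
    obtain rfl : h = g := by
      by_contra hne
      exact hg (by rw [hblock, MonoidAlgebra.coeff_single, Finsupp.single_eq_of_ne' hne])
    rfl
  · have hblock : block h = auxY (exponent h) := if_neg hh
    have hexponent := exponent_eq_of_mem_supp_auxY (hblock ▸ hg)
    rw [block, hexponent, if_neg hh, hblock]

lemma coeff_bElt_of_mem_supp [NeZero m] {i : Index m} {g : DihedralGroup m}
    (hg : g ∈ supp (bElt m i)) (j : Index m) [Decidable (j = i)] :
    (bElt m j).coeff g = if j = i then 1 else 0 := by
  have hblock {j : Index m} (hj : g ∈ supp (bElt m j)) : bElt m j = block g := by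
    obtain ⟨h, hh⟩ := exists_block_eq_bElt j
    rw [← hh] at hj ⊢
    exact (block_eq_of_mem_supp hj).symm
  split_ifs with hij
  · rw [hij, hblock hg, coeff_block_self]
  · by_contra hj
    exact hij ((bElt_indep (NeZero.pos m)).injective ((hblock hj).trans (hblock hg).symm))

end Dihedral

end DihedralWords

open scoped Classical in
theorem mainTheorem2_general {𝕜 : Type*} [RCLike 𝕜] {G : Type*} [Group G] [Fintype G]
    {Q : Subalgebra ℝ ℝ[G]} (θ : Q →ₐ[ℝ] DihedralWords.characterAlgebra 𝕜 G)
    {ι : Type*} [Fintype ι] (b : ι → Q)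
    (hb : Subalgebra.toSubmodule Q ≤ Submodule.span ℝ (Set.range fun i => (b i : ℝ[G])))
    (hθ : ∀ i, (θ (b i) : G → 𝕜) ∈ DihedralWords.irrCharacters 𝕜 G)
    {V : Type*} [AddCommGroup V] [Module 𝕜 V] [FiniteDimensional 𝕜 V]
    (ρ : Representation 𝕜 G V) (f : Q) (hf : (θ f : G → 𝕜) = ρ.character)
    {S : Type*} [AddCommGroup S] [Module 𝕜 S] [FiniteDimensional 𝕜 S]
    (τ : Representation 𝕜 G S) (hτ : τ.IsIrreducible)
    (σ : ι → G) (hσ : ∀ i j, (b j : ℝ[G]).coeff (σ i) = if j = i then 1 else 0) (d : ℕ) :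
    (DihedralWords.simpleMultiplicity τ (DihedralWords.tensorPower ρ d) : ℝ) =
      ∑ i with (θ (b i) : G → 𝕜) = τ.character,
        ∑ w ∈ DihedralWords.words (DihedralWords.supp (f : ℝ[G])) d (σ i),
          DihedralWords.wordWeight (f : ℝ[G]).coeff w := by
  have hpow : f ^ d = ∑ i, (f ^ d : ℝ[G]).coeff (σ i) • b i :=
    Subtype.ext (by simpa using DihedralWords.eq_sum_coeff_smul hσ (hb (f ^ d).2))
  have hcharacter : (DihedralWords.tensorPower ρ d).character =
      ∑ i, (f ^ d : ℝ[G]).coeff (σ i) • (θ (b i) : G → 𝕜) := by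
    rw [DihedralWords.character_tensorPower, ← hf, ← SubmonoidClass.coe_pow, ← map_pow, hpow]
    simp only [map_sum, map_smul, AddSubmonoidClass.coe_finsetSum, SetLike.val_smul]
  simp only [DihedralWords.simpleMultiplicity_eq_sum τ _ hθ hcharacter,
    DihedralWords.sum_wordWeight_words]

open scoped Classical in
theorem mainTheorem2 (𝕜 : Type*) [RCLike 𝕜] (m : ℕ) [NeZero m] (δ : ℤˣ)
    {V : Type*} [AddCommGroup V] [Module 𝕜 V] [FiniteDimensional 𝕜 V]
    (ρ : Representation 𝕜 (DihedralGroup m) V)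
    (f : DihedralWords.dihedralQ m)
    (hf : (DihedralWords.theta 𝕜 m δ f : DihedralGroup m → 𝕜) = ρ.character)
    {S : Type*} [AddCommGroup S] [Module 𝕜 S] [FiniteDimensional 𝕜 S]
    (τ : Representation 𝕜 (DihedralGroup m) S) (hτ : τ.IsIrreducible)
    (σ : DihedralWords.Index m → DihedralGroup m)
    (hσ : ∀ i, σ i ∈ DihedralWords.supp (DihedralWords.b i : ℝ[DihedralGroup m]))
    (d : ℕ) :
    (DihedralWords.simpleMultiplicity τ (DihedralWords.tensorPower ρ d) : ℝ) =
      ∑ i : DihedralWords.Index m with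
          (DihedralWords.theta 𝕜 m δ (DihedralWords.b i) : DihedralGroup m → 𝕜) = τ.character,
        ∑ w ∈ DihedralWords.words (DihedralWords.supp (f : ℝ[DihedralGroup m])) d (σ i),
          DihedralWords.wordWeight (f : ℝ[DihedralGroup m]).coeff w := by
  refine mainTheorem2_general (DihedralWords.theta 𝕜 m δ) DihedralWords.b le_rfl (fun i => ?_)
    ρ f hf τ hτ σ (fun i j => DihedralWords.coeff_bElt_of_mem_supp (hσ i) j) d
  rw [DihedralWords.theta_b]
  exact DihedralWords.indexChar_mem δ i
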